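/- Let $E$ be a (real or complex) Banach space of Rademacher type 2, i.e. there is $T\in(0,\infty)$ such that for all $n\in\mathbb N$ and $x_1,\dots,x_n\in E$, $$\frac1{2^n}\sum_{\delta\in\{-1,1\}^n}\Big\|\sum_{i=1}^n\delta_i x_i\Big\|_E^2\le T^2\sum_{i=1}^n\|x_i\|_E^2 .$$ For $f:\{-1,1\}^n\to E$ and $p\in[1,\infty)$ write $\mathbb E f=2^{-n}\sum_{x}f(x)$, $\|f\|_p=\big(2^{-n}\sum_{x}\|f(x)\|_E^p\big)^{1/p}$, where $x$ runs over $\{-1,1\}^n$, and $$\partial_i f(x)=\tfrac12\big(f(x)-f(x_1,\dots,x_{i-1},-x_i,x_{i+1},\dots,x_n)\big).$$ Then there is a constant $C=C(E)\in(0,\infty)$ such that for every $\varepsilon\in(0,1)$, every $n\in\mathbb N$ and every $f:\{-1,1\}^n\to E$, $$\|f-\mathbb E f\|_2^2\le\frac C\varepsilon\sum_{i=1}^n\frac{\|\partial_i f\|_2^2}{1+\log^{1-\varepsilon}\big(\|\partial_i f\|_2/\|\partial_i f\|_1\big)},$$ and, moreover, for every $n\in\mathbb N$ and every $f:\{-1,1\}^n\to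 E$, $$\|f-\mathbb E f\|_2^2\le C\,\sigma(f)\sum_{i=1}^n\frac{\|\partial_i f\|_2^2}{1+\log\big(\|\partial_i f\|_2/\|\partial_i f\|_1\big)},\qquad \sigma(f)=\max_{1\le i\le n}\log\log\Big(e+\frac{\|\partial_i f\|_2}{\|\partial_i f\|_1}\Big).$$ Here $\log^{a}(t)$ means $(\log t)^{a}$; indices $i$ with $\partial_i f=0$ contribute $0$ to the sums and $0$ to the maximum. -/

import Mathlib

/-- The discrete hypercube `{-1, 1}^n`; the units of `ℤ` are exactly `1` and `-1`. -/
abbrev Hypercube (n : ℕ) : Type := Fin n → ℤˣ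

namespace Hypercube

/-- The expectation of a vector-valued function with respect to the uniform probability measure
on `{-1, 1}^n`. -/
noncomputable def expect {n : ℕ} {E : Type*} [NormedAddCommGroup E] [NormedSpace ℝ E]
    (f : Hypercube n → E) : E :=
  ((2 : ℝ) ^ n)⁻¹ • ∑ x : Hypercube n, f x

/-- The norm of `f` in `L_p(σ_n; E)`, where `σ_n` is the uniform probability measure
on `{-1, 1}^n` and `1 ≤ p < ∞`. -/
noncomputable def lpNorm {n : ℕ} {E : Type*} [NormedAddCommGroup E] [NormedSpace ℝ E]
    (p : ℝ) (f : Hypercube n → E) : ℝ :=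
  (expect fun x => ‖f x‖ ^ p) ^ (1 / p)

/-- The `i`-th discrete partial derivative
`∂_i f (x) = (f (x) - f (x_1, …, x_{i-1}, -x_i, x_{i+1}, …, x_n)) / 2`. -/
noncomputable def partialDeriv {n : ℕ} {E : Type*} [NormedAddCommGroup E] [NormedSpace ℝ E]
    (i : Fin n) (f : Hypercube n → E) : Hypercube n → E :=
  fun x => (2 : ℝ)⁻¹ • (f x - f (Function.update x i (-x i)))

/-- The ratio `‖∂_i f‖_{L_2(σ_n; E)} / ‖∂_i f‖_{L_1(σ_n; E)}`. It is at least `1` if `∂_i f ≠ 0`,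
and it has the value `0` (from `0 / 0`) if `∂_i f = 0`. -/
noncomputable def normRatio {n : ℕ} {E : Type*} [NormedAddCommGroup E] [NormedSpace ℝ E]
    (i : Fin n) (f : Hypercube n → E) : ℝ :=
  lpNorm 2 (partialDeriv i f) / lpNorm 1 (partialDeriv i f)

/-- The quantity `max_i log log (e + ‖∂_i f‖_{L_2(σ_n; E)} / ‖∂_i f‖_{L_1(σ_n; E)})`.
Indices with `∂_i f = 0` contribute `log log e = 0`, all others contribute at least
`log log (e + 1) > 0`; for `n = 0` the value is `0`. -/
noncomputable def logLogFactor {n : ℕ} {E : Type*} [NormedAddCommGroup E] [NormedSpace ℝ E]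
    (f : Hypercube n → E) : ℝ :=
  ⨆ i : Fin n, Real.log (Real.log (Real.exp 1 + normRatio i f))

end Hypercube

/-- The normed space `E` has Rademacher type `s` with constant `T`. -/
def HasRademacherTypeWith (E : Type*) [NormedAddCommGroup E] [NormedSpace ℝ E] (s T : ℝ) : Prop :=
  ∀ (n : ℕ) (v : Fin n → E),
    Hypercube.expect (fun x : Hypercube n => ‖∑ i, ((x i : ℤ) : ℝ) • v i‖ ^ s)
      ≤ T ^ s * ∑ i, ‖v i‖ ^ s

/-- The normed space `E` has Rademacher type `s` (with some constant in `(0, ∞)`). -/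
def HasRademacherType (E : Type*) [NormedAddCommGroup E] [NormedSpace ℝ E] (s : ℝ) : Prop :=
  ∃ T : ℝ, 0 < T ∧ HasRademacherTypeWith E s T

/-! ### Biased product weights and the noise operator -/

namespace Hypercube

variable {n : ℕ} {E : Type*} [NormedAddCommGroup E] [NormedSpace ℝ E]

/-! Let `N_t` be the noise operator averaging `f (x * z)` over signs `z` of mean `t`. The path `t ↦
N_t N_t f` runs in `L_2` from the mean of `f` at `t = 0` to `f` at `t = 1`, with velocity `2 N_t'
N_t f`. The operator is used twice because each copy has its own task.

The derivative `N_t'` is handled by type 2. Up to the factor `1 - t ^ 2`, `N_t' g (x)` is an average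
over `z` of `∑ i, (z i - t) • ∂_i g (x * z)`. For fixed `z`, translating `x` decouples the vectors
from the signs, and symmetrization gives type 2 for centred biased signs
(`expect_norm_sum_biasDeriv_sq_le`).

The second copy commutes with `∂_i` and smooths. Bonami's inequality followed by Hölder shrinks
`‖∂_i f‖_2 ^ 2` by `exp (-L_i (1 - t))`, where `L_i` is the logarithm of the norm ratio
(`expect_noise_sq_le_exp`).

With `u = 1 - t`, the squared speed is thus at most a constant times `S(u) / u`, where `S(u) = ∑ i,
‖∂_i f‖_2 ^ 2 exp (-L_i u)`. Cauchy–Schwarz against `u ^ (ε - 1)`, of integral `1 / ε`, bounds the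
squared displacement by `ε⁻¹ ∫ u ^ (-ε) S(u)` (`norm_sub_sq_le_integral`), and a Gamma integral
produces `1 / (1 + L_i ^ (1 - ε))`. The second inequality follows by taking `ε` of order `1 / (2 +
σ(f))`, for which `L_i ^ ε` is bounded. -/

theorem coe_unit_sq (u : ℤˣ) : ((u : ℤ) : ℝ) * ((u : ℤ) : ℝ) = 1 := by
  rcases Int.units_eq_one_or u with h | h <;> simp [h]

theorem sum_units {M : Type*} [AddCommMonoid M] (F : ℤˣ → M) : ∑ u, F u = F 1 + F (-1) := by
  rw [UnitsInt.univ, Finset.sum_pair (by decide)]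

theorem expect_real (F : Hypercube n → ℝ) : expect F = ((2 : ℝ) ^ n)⁻¹ * ∑ x, F x := rfl

theorem expect_mono {F G : Hypercube n → ℝ} (h : ∀ x, F x ≤ G x) : expect F ≤ expect G :=
  mul_le_mul_of_nonneg_left (Finset.sum_le_sum fun x _ => h x) (by positivity)

theorem expect_nonneg {F : Hypercube n → ℝ} (h : ∀ x, 0 ≤ F x) : 0 ≤ expect F :=
  mul_nonneg (by positivity) (Finset.sum_nonneg fun x _ => h x)

theorem expect_mul_left (c : ℝ) (F : Hypercube n → ℝ) :
    expect (fun x => c * F x) = c * expect F := by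
  simp only [expect_real, ← Finset.mul_sum]; ring

theorem expect_sum {ι : Type*} (s : Finset ι) (F : ι → Hypercube n → ℝ) :
    expect (fun x => ∑ i ∈ s, F i x) = ∑ i ∈ s, expect (F i) := by
  simp only [expect_real, ← Finset.mul_sum]
  rw [Finset.sum_comm]

theorem expect_const (c : ℝ) : expect (fun _ : Hypercube n => c) = c := by
  simp [expect_real, Fintype.card_units_int]

theorem expect_mul_right (F : Hypercube n → E) (z : Hypercube n) :
    expect (fun x => F (x * z)) = expect F := by
  unfold expect
  rw [← Equiv.sum_comp (Equiv.mulRight z) F]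
  rfl

/-- The bias weights: `bias ρ z` is the probability of `z` when the coordinates are independent
signs of mean `ρ`. -/
noncomputable def bias (ρ : ℝ) (z : Hypercube n) : ℝ := ∏ i, (1 + ρ * ((z i : ℤ) : ℝ)) / 2

theorem bias_nonneg {ρ : ℝ} (h0 : 0 ≤ ρ) (h1 : ρ ≤ 1) (z : Hypercube n) : 0 ≤ bias ρ z := by
  refine Finset.prod_nonneg fun i _ => ?_
  rcases Int.units_eq_one_or (z i) with h | h <;> simp [h] <;> linarith

theorem sum_bias (ρ : ℝ) : ∑ z : Hypercube n, bias ρ z = 1 := by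
  unfold bias
  rw [← Fintype.prod_sum (fun (_ : Fin n) (u : ℤˣ) => (1 + ρ * ((u : ℤ) : ℝ)) / 2)]
  refine Finset.prod_eq_one fun i _ => ?_
  rw [sum_units]
  push_cast
  ring

theorem bias_zero (z : Hypercube n) : bias 0 z = ((2 : ℝ) ^ n)⁻¹ := by
  simp [bias]

theorem bias_one (z : Hypercube n) : bias 1 z = if z = 1 then 1 else 0 := by
  split_ifs with h
  · simp [bias, h]
  · obtain ⟨i, hi⟩ := Function.ne_iff.1 h
    refine Finset.prod_eq_zero (Finset.mem_univ i) ?_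
    simp [(Int.units_eq_one_or (z i)).resolve_left hi]

/-- The map flipping the sign of the `i`-th coordinate. -/
def flip (i : Fin n) : Equiv.Perm (Hypercube n) :=
  Function.Involutive.toPerm (fun x => Function.update x i (-x i)) fun x => by simp

theorem flip_apply (i : Fin n) (x : Hypercube n) : flip i x = Function.update x i (-x i) := rfl

theorem mul_flip (i : Fin n) (x z : Hypercube n) : x * flip i z = flip i (x * z) := by
  ext j
  by_cases h : j = i
  · subst h; simp [flip_apply]
  · simp [flip_apply, h]

theorem flip_mul (i : Fin n) (x z : Hypercube n) : flip i x * z = flip i (x * z) := by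
  rw [mul_comm, mul_flip, mul_comm]

theorem flip_flip (i : Fin n) (x : Hypercube n) : flip i (flip i x) = x := by
  simp [flip_apply]

theorem bias_eq_mul (ρ : ℝ) (i : Fin n) (z : Hypercube n) :
    bias ρ z = (1 + ρ * ((z i : ℤ) : ℝ)) / 2 *
      ∏ j ∈ Finset.univ.erase i, (1 + ρ * ((z j : ℤ) : ℝ)) / 2 :=
  (Finset.mul_prod_erase _ _ (Finset.mem_univ i)).symm

/-- Since `z_i ^ 2 = 1`, `(1 + ρ z_i) (z_i - ρ) = (1 - ρ ^ 2) z_i`, which is odd in `z_i`; the other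
factors do not see the flip. -/
theorem bias_mul_sub_flip (ρ : ℝ) (i : Fin n) (z : Hypercube n) :
    bias ρ (flip i z) * (((flip i z i : ℤˣ) : ℤ) - ρ) = -(bias ρ z * (((z i : ℤˣ) : ℤ) - ρ)) := by
  have hp : ∏ j ∈ Finset.univ.erase i, (1 + ρ * (((flip i z) j : ℤ) : ℝ)) / 2 =
      ∏ j ∈ Finset.univ.erase i, (1 + ρ * ((z j : ℤ) : ℝ)) / 2 := by
    refine Finset.prod_congr rfl fun j hj => ?_
    rw [flip_apply, Function.update_of_ne (Finset.ne_of_mem_erase hj)]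
  rw [bias_eq_mul ρ i, hp, bias_eq_mul ρ i z]
  simp only [flip_apply, Function.update_self, Units.val_neg, Int.cast_neg]
  have := coe_unit_sq (z i)
  linear_combination (ρ * ∏ j ∈ Finset.univ.erase i, (1 + ρ * ((z j : ℤ) : ℝ)) / 2) * this

/-- Functions independent of the `i`-th coordinate integrate to zero against `z_i - ρ`. -/
theorem sum_bias_mul_sub_smul_eq_zero (ρ : ℝ) (i : Fin n) (h : Hypercube n → E)
    (hh : ∀ z, h (flip i z) = h z) :
    ∑ z, (bias ρ z * (((z i : ℤˣ) : ℤ) - ρ)) • h z = 0 := by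
  have key : ∑ z, (bias ρ z * (((z i : ℤˣ) : ℤ) - ρ)) • h z =
      -∑ z, (bias ρ z * (((z i : ℤˣ) : ℤ) - ρ)) • h z := by
    conv_lhs => rw [← Equiv.sum_comp (flip i)]
    rw [← Finset.sum_neg_distrib]
    refine Finset.sum_congr rfl fun z _ => ?_
    rw [bias_mul_sub_flip, hh, neg_smul]
  have h2 := eq_neg_iff_add_eq_zero.1 key
  rw [← two_smul ℝ] at h2
  exact (smul_eq_zero.1 h2).resolve_left two_ne_zero

theorem sum_bias_mul_coord (ρ : ℝ) (i : Fin n) :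
    ∑ z, bias ρ z * (((z i : ℤˣ) : ℤ) : ℝ) = ρ := by
  have h := sum_bias_mul_sub_smul_eq_zero ρ i (fun _ : Hypercube n => (1 : ℝ)) fun _ => rfl
  simp only [smul_eq_mul, mul_one, mul_sub, Finset.sum_sub_distrib, ← Finset.sum_mul, sum_bias,
    one_mul] at h
  linarith

/-- The derivative of `bias` in the correlation parameter. -/
noncomputable def biasDeriv (ρ : ℝ) (z : Hypercube n) : ℝ :=
  ∑ i, (∏ j ∈ Finset.univ.erase i, (1 + ρ * ((z j : ℤ) : ℝ)) / 2) • (((z i : ℤ) : ℝ) / 2)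

theorem hasDerivAt_bias (ρ : ℝ) (z : Hypercube n) :
    HasDerivAt (fun ρ => bias ρ z) (biasDeriv ρ z) ρ := by
  unfold bias biasDeriv
  refine HasDerivAt.fun_finsetProd fun i _ => ?_
  have := (((hasDerivAt_id ρ).mul_const ((z i : ℤ) : ℝ)).const_add 1).div_const 2
  simpa using this

theorem continuous_bias (z : Hypercube n) : Continuous fun ρ => bias ρ z := by
  unfold bias; fun_prop

theorem continuous_biasDeriv (z : Hypercube n) : Continuous fun ρ => biasDeriv ρ z := by
  unfold biasDeriv; fun_prop

/-- The same identity `(1 + ρ z_i) (z_i - ρ) = (1 - ρ ^ 2) z_i`, read backwards: it expresses the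
derivative through the centred variables `z_i - ρ` under the original probability weight. -/
theorem one_sub_sq_mul_biasDeriv (ρ : ℝ) (z : Hypercube n) :
    (1 - ρ ^ 2) * biasDeriv ρ z = ∑ i, bias ρ z * (((z i : ℤˣ) : ℤ) - ρ) := by
  unfold biasDeriv
  rw [Finset.mul_sum]
  refine Finset.sum_congr rfl fun i _ => ?_
  rw [bias_eq_mul ρ i, smul_eq_mul]
  have := coe_unit_sq (z i)
  linear_combination
    (-(ρ / 2) * ∏ j ∈ Finset.univ.erase i, (1 + ρ * ((z j : ℤ) : ℝ)) / 2) * this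

/-- The noise operator. -/
noncomputable def noise (ρ : ℝ) (f : Hypercube n → E) : Hypercube n → E :=
  fun x => ∑ z, bias ρ z • f (x * z)

theorem noise_partialDeriv (ρ : ℝ) (i : Fin n) (f : Hypercube n → E) :
    noise ρ (partialDeriv i f) = partialDeriv i (noise ρ f) := by
  funext x
  simp only [noise, partialDeriv, ← flip_apply]
  rw [← Finset.sum_sub_distrib, Finset.smul_sum]
  refine Finset.sum_congr rfl fun z _ => ?_
  rw [flip_mul, ← smul_sub, smul_comm]

theorem norm_noise_le {ρ : ℝ} (h0 : 0 ≤ ρ) (h1 : ρ ≤ 1) (f : Hypercube n → E) (x : Hypercube n) :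
    ‖noise ρ f x‖ ≤ noise ρ (fun y => ‖f y‖) x := by
  refine norm_sum_le_of_le _ fun z _ => ?_
  rw [norm_smul, Real.norm_of_nonneg (bias_nonneg h0 h1 z), smul_eq_mul]

theorem noise_nonneg {ρ : ℝ} (h0 : 0 ≤ ρ) (h1 : ρ ≤ 1) {g : Hypercube n → ℝ} (hg : ∀ x, 0 ≤ g x)
    (x : Hypercube n) : 0 ≤ noise ρ g x :=
  Finset.sum_nonneg fun z _ => mul_nonneg (bias_nonneg h0 h1 z) (hg _)

/-- The difference `g - ∂_i g` is the average of `g` over the `i`-th coordinate, so it is invariant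
under the flip and is annihilated by `z_i - ρ`. -/
theorem sum_bias_mul_sub_smul_partialDeriv (ρ : ℝ) (i : Fin n) (g : Hypercube n → E)
    (x : Hypercube n) :
    ∑ z, (bias ρ z * (((z i : ℤˣ) : ℤ) - ρ)) • g (x * z) =
      ∑ z, (bias ρ z * (((z i : ℤˣ) : ℤ) - ρ)) • partialDeriv i g (x * z) := by
  rw [← sub_eq_zero, ← Finset.sum_sub_distrib]
  simp only [← smul_sub]
  refine sum_bias_mul_sub_smul_eq_zero ρ i (fun z => g (x * z) - partialDeriv i g (x * z))
    fun z => ?_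
  simp only [partialDeriv, ← flip_apply, mul_flip, flip_flip]
  module

theorem one_sub_sq_smul_sum_biasDeriv (ρ : ℝ) (g : Hypercube n → E) (x : Hypercube n) :
    (1 - ρ ^ 2) • ∑ z, biasDeriv ρ z • g (x * z) =
      ∑ z, bias ρ z • ∑ i, ((((z i : ℤˣ) : ℤ) : ℝ) - ρ) • partialDeriv i g (x * z) := by
  simp only [Finset.smul_sum, smul_smul, one_sub_sq_mul_biasDeriv, Finset.sum_smul]
  rw [Finset.sum_comm, Finset.sum_congr rfl fun i _ => sum_bias_mul_sub_smul_partialDeriv ρ i g x,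
    Finset.sum_comm]

end Hypercube

/-! ### The two-point inequality -/

/-- A Bernoulli-type inequality behind the two-point inequality. -/
theorem two_mul_le_rpow_sub_rpow {q y : ℝ} (hq0 : 0 < q) (hq1 : q < 1) (hy0 : 0 ≤ y) (hy1 : y ≤ 1) :
    2 * q * y ≤ (1 + y) ^ q - (1 - y) ^ q := by
  have hmono : MonotoneOn (fun y : ℝ => (1 + y) ^ q - (1 - y) ^ q - 2 * q * y) (Set.Icc 0 1) := by
    have hd : ∀ y ∈ interior (Set.Icc (0 : ℝ) 1),
        HasDerivAt (fun y : ℝ => (1 + y) ^ q - (1 - y) ^ q - 2 * q * y)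
          (q * ((1 + y) ^ (q - 1) + (1 - y) ^ (q - 1) - 2)) y := by
      intro y hy
      rw [interior_Icc] at hy
      have h1 := ((hasDerivAt_id' y).const_add 1).rpow_const (p := q)
        (Or.inl (by linarith [hy.1]))
      have h2 := ((hasDerivAt_id' y).const_sub 1).rpow_const (p := q)
        (Or.inl (by linarith [hy.2]))
      have h3 := (hasDerivAt_id' y).const_mul (2 * q)
      refine ((h1.sub h2).sub h3).congr_deriv ?_
      ring
    refine monotoneOn_of_deriv_nonneg (convex_Icc 0 1) ?_
      (fun y hy => (hd y hy).differentiableAt.differentiableWithinAt) fun y hy => ?_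
    · refine ContinuousOn.sub (ContinuousOn.sub ?_ ?_) (by fun_prop)
      · exact ContinuousOn.rpow_const (by fun_prop) fun _ _ => Or.inr hq0.le
      · exact ContinuousOn.rpow_const (by fun_prop) fun _ _ => Or.inr hq0.le
    · rw [(hd y hy).deriv]
      rw [interior_Icc] at hy
      have ha : 0 < 1 + y := by linarith [hy.1]
      have hb : 0 < 1 - y := by linarith [hy.2]
      have hA := Real.rpow_pos_of_pos ha (q - 1)
      have hB := Real.rpow_pos_of_pos hb (q - 1)
      -- The product is `(1 - y ^ 2) ^ (q - 1)` with a negative exponent, so it is at least `1`; by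
      -- AM-GM the sum of the two powers is at least `2`.
      have hAB : 1 ≤ (1 + y) ^ (q - 1) * (1 - y) ^ (q - 1) := by
        rw [← Real.mul_rpow ha.le hb.le]
        refine Real.one_le_rpow_of_pos_of_le_one_of_nonpos (mul_pos ha hb) ?_ (by linarith)
        linarith [mul_pos hy.1 hy.1, show (1 + y) * (1 - y) = 1 - y * y by ring]
      refine mul_nonneg hq0.le ?_
      nlinarith [sq_nonneg ((1 + y) ^ (q - 1) - (1 - y) ^ (q - 1))]
  have := hmono (Set.left_mem_Icc.2 zero_le_one) ⟨hy0, hy1⟩ hy0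
  simp at this
  linarith

/-- Both sides agree at `y = 0`, and the derivative of their difference is nonnegative by
`two_mul_le_rpow_sub_rpow` with `q = p - 1`. -/
theorem one_add_sq_le_rpow_add_rpow {p y : ℝ} (hp1 : 1 < p) (hp2 : p < 2) (hy0 : 0 ≤ y)
    (hy1 : y ≤ 1) : 1 + p * (p - 1) / 2 * y ^ 2 ≤ ((1 + y) ^ p + (1 - y) ^ p) / 2 := by
  have hmono : MonotoneOn (fun y : ℝ => ((1 + y) ^ p + (1 - y) ^ p) / 2 - p * (p - 1) / 2 * y ^ 2)
      (Set.Icc 0 1) := by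
    have hd : ∀ y : ℝ, HasDerivAt
        (fun y : ℝ => ((1 + y) ^ p + (1 - y) ^ p) / 2 - p * (p - 1) / 2 * y ^ 2)
          (p / 2 * ((1 + y) ^ (p - 1) - (1 - y) ^ (p - 1) - 2 * (p - 1) * y)) y := by
      intro y
      have h1 := ((hasDerivAt_id' y).const_add 1).rpow_const (p := p) (Or.inr hp1.le)
      have h2 := ((hasDerivAt_id' y).const_sub 1).rpow_const (p := p) (Or.inr hp1.le)
      have h3 := ((hasDerivAt_id' y).pow 2).const_mul (p * (p - 1) / 2)
      refine (((h1.add h2).div_const 2).sub h3).congr_deriv ?_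
      ring
    refine monotoneOn_of_deriv_nonneg (convex_Icc 0 1)
      (fun y _ => (hd y).continuousAt.continuousWithinAt)
      (fun y _ => (hd y).differentiableAt.differentiableWithinAt) fun y hy => ?_
    rw [(hd y).deriv]
    rw [interior_Icc] at hy
    have := two_mul_le_rpow_sub_rpow (q := p - 1) (by linarith) (by linarith) hy.1.le hy.2.le
    exact mul_nonneg (by linarith) (by linarith)
  have := hmono (Set.left_mem_Icc.2 zero_le_one) ⟨hy0, hy1⟩ hy0
  simp at this
  linarith

/-- The Bonami–Beckner two-point inequality for nonnegative values. -/
theorem two_point_inequality {p u v : ℝ} (hp1 : 1 < p) (hp2 : p < 2) (hu : 0 ≤ u) (hv : 0 ≤ v) :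
    ((u + v) / 2) ^ 2 + (p - 1) * ((u - v) / 2) ^ 2 ≤ ((u ^ p + v ^ p) / 2) ^ (2 / p) := by
  wlog huv : v ≤ u generalizing u v
  · have := this hv hu (le_of_not_ge huv)
    rw [add_comm v u, add_comm (v ^ p)] at this
    linarith [sq_nonneg ((u - v) / 2), show ((u - v) / 2) ^ 2 = ((v - u) / 2) ^ 2 by ring]
  rcases hu.eq_or_lt with rfl | hu0
  · have : v = 0 := le_antisymm huv hv
    subst this
    simp only [add_zero, sub_zero, zero_div]
    have : (0 : ℝ) ≤ ((0 ^ p + 0 ^ p) / 2) ^ (2 / p) := by positivity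
    simpa using this
  set a := (u + v) / 2 with ha
  have ha0 : 0 < a := by positivity
  set y := (u - v) / 2 / a with hy
  have hy0 : 0 ≤ y := div_nonneg (by linarith) ha0.le
  have hy1 : y ≤ 1 := (div_le_one ha0).2 (by linarith)
  have hya : (u - v) / 2 = a * y := by rw [hy]; field_simp
  have hu' : u = a * (1 + y) := by linarith [ha, hya]
  have hv' : v = a * (1 - y) := by linarith [ha, hya]
  have h1 := one_add_sq_le_rpow_add_rpow hp1 hp2 hy0 hy1
  -- Bernoulli with exponent `p / 2 ≤ 1`: the resulting coefficient `p (p - 1) / 2` is exactly the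
  -- one in `h1`.
  have h2 := rpow_one_add_le_one_add_mul_self (s := (p - 1) * y ^ 2) (p := p / 2)
    (by nlinarith [sq_nonneg y]) (by linarith) (by linarith)
  have hs : 0 ≤ 1 + (p - 1) * y ^ 2 := by nlinarith [sq_nonneg y]
  have h3 : 1 + (p - 1) * y ^ 2 ≤ (((1 + y) ^ p + (1 - y) ^ p) / 2) ^ (2 / p) := by
    calc 1 + (p - 1) * y ^ 2 = ((1 + (p - 1) * y ^ 2) ^ (p / 2)) ^ (2 / p) := by
          rw [← Real.rpow_mul hs, show p / 2 * (2 / p) = 1 by field_simp, Real.rpow_one]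
      _ ≤ _ := by
          refine Real.rpow_le_rpow (by positivity) ?_ (by positivity)
          linarith
  have h4 : (u ^ p + v ^ p) / 2 = a ^ p * (((1 + y) ^ p + (1 - y) ^ p) / 2) := by
    rw [hu', hv', Real.mul_rpow ha0.le (by linarith), Real.mul_rpow ha0.le (by linarith)]
    ring
  have h5 : (a ^ p) ^ (2 / p) = a ^ 2 := by
    rw [← Real.rpow_mul ha0.le, show p * (2 / p) = 2 by field_simp, Real.rpow_two]
  have hn : 0 ≤ ((1 + y) ^ p + (1 - y) ^ p) / 2 := by
    have : 0 ≤ 1 - y := by linarith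
    positivity
  rw [h4, Real.mul_rpow (by positivity) hn, h5, hya]
  calc a ^ 2 + (p - 1) * (a * y) ^ 2 = a ^ 2 * (1 + (p - 1) * y ^ 2) := by ring
    _ ≤ _ := mul_le_mul_of_nonneg_left h3 (by positivity)

/-! ### Hypercontractivity -/

namespace Hypercube

variable {n : ℕ} {E : Type*} [NormedAddCommGroup E] [NormedSpace ℝ E]

theorem sum_succ {M : Type*} [AddCommMonoid M] (F : Hypercube (n + 1) → M) :
    ∑ x, F x = ∑ x : Hypercube n, (F (Fin.cons 1 x) + F (Fin.cons (-1) x)) := by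
  rw [← Equiv.sum_comp (Fin.consEquiv fun _ => ℤˣ), Fintype.sum_prod_type_right]
  exact Finset.sum_congr rfl fun x _ => sum_units _

theorem expect_succ (F : Hypercube (n + 1) → ℝ) :
    expect F = expect fun x : Hypercube n => (F (Fin.cons 1 x) + F (Fin.cons (-1) x)) / 2 := by
  rw [expect_real, expect_real, sum_succ, ← Finset.sum_div, pow_succ]
  field_simp

theorem bias_cons (ρ : ℝ) (u : ℤˣ) (z : Hypercube n) :
    bias ρ (Fin.cons u z : Hypercube (n + 1)) = (1 + ρ * ((u : ℤ) : ℝ)) / 2 * bias ρ z := by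
  simp only [bias, Fin.prod_univ_succ, Fin.cons_zero, Fin.cons_succ]

theorem cons_mul_cons (u v : ℤˣ) (x z : Hypercube n) :
    (Fin.cons u x * Fin.cons v z : Hypercube (n + 1)) = Fin.cons (u * v) (x * z) := by
  ext i
  refine Fin.cases ?_ (fun j => ?_) i <;> simp

theorem noise_cons (ρ : ℝ) (g : Hypercube (n + 1) → ℝ) (u : ℤˣ) (x : Hypercube n) :
    noise ρ g (Fin.cons u x) = (1 + ρ) / 2 * noise ρ (fun y => g (Fin.cons u y)) x +
      (1 - ρ) / 2 * noise ρ (fun y => g (Fin.cons (-u) y)) x := by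
  simp only [noise, sum_succ, bias_cons, cons_mul_cons, Finset.mul_sum, ← Finset.sum_add_distrib]
  refine Finset.sum_congr rfl fun z _ => ?_
  simp only [mul_one, mul_neg, Units.val_one, Units.val_neg, Int.cast_one, Int.cast_neg, smul_eq_mul]
  ring

theorem expect_add_rpow_le {q : ℝ} (hq : 1 ≤ q) {A B : Hypercube n → ℝ} (hA : ∀ x, 0 ≤ A x)
    (hB : ∀ x, 0 ≤ B x) : expect (fun x => (A x + B x) ^ q) ≤
      ((expect fun x => A x ^ q) ^ (1 / q) + (expect fun x => B x ^ q) ^ (1 / q)) ^ q := by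
  have h := Real.Lp_add_le_of_nonneg Finset.univ hq (fun x _ => hA x) (fun x _ => hB x)
  have hs : ∀ F : Hypercube n → ℝ, (∀ x, 0 ≤ F x) → 0 ≤ ∑ x, F x ^ q := fun F hF =>
    Finset.sum_nonneg fun x _ => Real.rpow_nonneg (hF x) q
  have hc : (0 : ℝ) ≤ ((2 : ℝ) ^ n)⁻¹ := by positivity
  have hAB := hs (fun x => A x + B x) fun x => add_nonneg (hA x) (hB x)
  have h' : (expect fun x => (A x + B x) ^ q) ^ (1 / q) ≤
      (expect fun x => A x ^ q) ^ (1 / q) + (expect fun x => B x ^ q) ^ (1 / q) := by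
    simp only [expect_real]
    rw [Real.mul_rpow hc hAB, Real.mul_rpow hc (hs A hA), Real.mul_rpow hc (hs B hB), ← mul_add]
    exact mul_le_mul_of_nonneg_left h (Real.rpow_nonneg hc _)
  have h0 : 0 ≤ expect fun x => (A x + B x) ^ q := mul_nonneg hc hAB
  calc expect (fun x => (A x + B x) ^ q) = ((expect fun x => (A x + B x) ^ q) ^ (1 / q)) ^ q := by
        rw [← Real.rpow_mul h0, one_div_mul_cancel (by linarith), Real.rpow_one]
    _ ≤ _ := Real.rpow_le_rpow (Real.rpow_nonneg h0 _) h' (by linarith)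

/-- Bonami's hypercontractive inequality from `L_{1 + ρ²}` to `L_2`. -/
theorem expect_noise_sq_le {ρ : ℝ} (h0 : 0 < ρ) (h1 : ρ < 1) (g : Hypercube n → ℝ)
    (hg : ∀ x, 0 ≤ g x) : expect (fun x => noise ρ g x ^ 2) ≤
      (expect fun x => g x ^ (1 + ρ ^ 2)) ^ (2 / (1 + ρ ^ 2)) := by
  have hp1 : 1 < 1 + ρ ^ 2 := by nlinarith
  have hp2 : 1 + ρ ^ 2 < 2 := by nlinarith
  generalize hp : 1 + ρ ^ 2 = p at hp1 hp2 ⊢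
  induction n with
  | zero =>
    have : ∀ F : Hypercube 0 → ℝ, expect F = F 1 := fun F => by
      simp only [expect_real, pow_zero, inv_one, one_mul, Fintype.sum_subsingleton F 1]
    rw [this, this, ← Real.rpow_mul (hg 1), show p * (2 / p) = 2 by field_simp, Real.rpow_two]
    have hn : noise ρ g 1 = g 1 := by
      rw [noise, Fintype.sum_subsingleton _ (1 : Hypercube 0)]
      simp [bias]
    rw [hn]
  | succ n ih =>
    set u := noise ρ fun y : Hypercube n => g (Fin.cons 1 y) with hu
    set v := noise ρ fun y : Hypercube n => g (Fin.cons (-1) y) with hv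
    have hu0 : ∀ x, 0 ≤ u x := noise_nonneg h0.le h1.le fun y => hg _
    have hv0 : ∀ x, 0 ≤ v x := noise_nonneg h0.le h1.le fun y => hg _
    have ihu := ih (fun y => g (Fin.cons 1 y)) fun y => hg _
    have ihv := ih (fun y => g (Fin.cons (-1) y)) fun y => hg _
    have hp0 : 0 < p := by linarith
    -- Puts the induction hypothesis in the form of an `L_{2/p}` norm of `w ^ p / 2`, which is what
    -- Minkowski's inequality produces below.
    have norm_half : ∀ w G : Hypercube n → ℝ, (∀ x, 0 ≤ w x) → (∀ x, 0 ≤ G x) →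
        expect (fun x => w x ^ 2) ≤ (expect G) ^ (2 / p) →
        (expect fun x => (w x ^ p / 2) ^ (2 / p)) ^ (1 / (2 / p)) ≤ expect G / 2 := by
      intro w G hw hG hle
      have e1 : ∀ x, (w x ^ p / 2) ^ (2 / p) = (1 / 2) ^ (2 / p) * w x ^ 2 := fun x => by
        rw [div_eq_inv_mul, Real.mul_rpow (by norm_num) (Real.rpow_nonneg (hw x) _),
          ← Real.rpow_mul (hw x), show p * (2 / p) = 2 by field_simp, Real.rpow_two, one_div]
      have hG0 := expect_nonneg hG
      have hw0 : 0 ≤ expect fun x => w x ^ 2 := expect_nonneg fun x => sq_nonneg _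
      simp only [e1]
      rw [expect_mul_left, Real.mul_rpow (by positivity) hw0, ← Real.rpow_mul (by norm_num),
        show 2 / p * (1 / (2 / p)) = 1 by field_simp, Real.rpow_one]
      have : (expect fun x => w x ^ 2) ^ (1 / (2 / p)) ≤ expect G := by
        calc _ ≤ ((expect G) ^ (2 / p)) ^ (1 / (2 / p)) :=
              Real.rpow_le_rpow hw0 hle (by positivity)
          _ = expect G := by
              rw [← Real.rpow_mul hG0, show 2 / p * (1 / (2 / p)) = 1 by field_simp, Real.rpow_one]
      linarith
    have hU := norm_half u _ hu0 (fun y => Real.rpow_nonneg (hg (Fin.cons 1 y)) p) ihu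
    have hV := norm_half v _ hv0 (fun y => Real.rpow_nonneg (hg (Fin.cons (-1) y)) p) ihv
    have hq : 1 ≤ 2 / p := (one_le_div hp0).2 hp2.le
    -- Noise in the first coordinate sends the pair `u, v` to `(u + v) / 2 ± ρ (u - v) / 2`; the
    -- mean of the squares is the left side of the two-point inequality, as `ρ ^ 2 = p - 1`.
    calc expect (fun x => noise ρ g x ^ 2)
        = expect fun x => ((u x + v x) / 2) ^ 2 + (p - 1) * ((u x - v x) / 2) ^ 2 := by
          rw [expect_succ]
          congr 1
          funext x
          rw [noise_cons, noise_cons, neg_neg, ← hu, ← hv, ← hp]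
          ring
      _ ≤ expect fun x => (u x ^ p / 2 + v x ^ p / 2) ^ (2 / p) := by
          refine expect_mono fun x => ?_
          rw [← add_div]
          exact two_point_inequality hp1 hp2 (hu0 x) (hv0 x)
      _ ≤ _ := expect_add_rpow_le hq (fun x => by have := hu0 x; positivity)
          fun x => by have := hv0 x; positivity
      _ ≤ _ := by
          refine Real.rpow_le_rpow ?_ (add_le_add hU hV) (by positivity)
          refine add_nonneg (Real.rpow_nonneg (expect_nonneg fun x => ?_) _)
            (Real.rpow_nonneg (expect_nonneg fun x => ?_) _)
          · have := hu0 x; positivity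
          · have := hv0 x; positivity
      _ = _ := by
          rw [expect_succ]
          congr 1
          simp only [expect_real, ← Finset.sum_div, Finset.sum_add_distrib]
          ring

/-- Hölder's inequality between the moments of order `1`, `p` and `2`. -/
theorem expect_rpow_le {p : ℝ} (hp1 : 1 < p) (hp2 : p < 2) (g : Hypercube n → ℝ)
    (hg : ∀ x, 0 ≤ g x) :
    expect (fun x => g x ^ p) ≤ (expect fun x => g x ^ 2) ^ (p - 1) * (expect g) ^ (2 - p) := by
  have hc : (0 : ℝ) ≤ ((2 : ℝ) ^ n)⁻¹ := by positivity
  have hc' : (0 : ℝ) < ((2 : ℝ) ^ n)⁻¹ := by positivity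
  have ha : 0 < p - 1 := by linarith
  have hb : 0 < 2 - p := by linarith
  have hconj := Real.HolderConjugate.inv_inv ha hb (by ring)
  -- The normalizing constant may sit inside the powers because the exponents `p - 1` and `2 - p`
  -- add up to `1`.
  have h := Real.inner_le_Lp_mul_Lq_of_nonneg Finset.univ hconj
    (f := fun x => (((2 : ℝ) ^ n)⁻¹ * g x ^ 2) ^ (p - 1))
    (g := fun x => (((2 : ℝ) ^ n)⁻¹ * g x) ^ (2 - p))
    (fun x _ => Real.rpow_nonneg (by positivity) _)
    (fun x _ => Real.rpow_nonneg (mul_nonneg hc (hg x)) _)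
  have e1 : ∀ x, ((((2 : ℝ) ^ n)⁻¹ * g x ^ 2) ^ (p - 1)) ^ (p - 1)⁻¹ = ((2 : ℝ) ^ n)⁻¹ * g x ^ 2 :=
    fun x => Real.rpow_rpow_inv (by positivity) ha.ne'
  have e2 : ∀ x, ((((2 : ℝ) ^ n)⁻¹ * g x) ^ (2 - p)) ^ (2 - p)⁻¹ = ((2 : ℝ) ^ n)⁻¹ * g x :=
    fun x => Real.rpow_rpow_inv (mul_nonneg hc (hg x)) hb.ne'
  have e3 : ∀ x, (((2 : ℝ) ^ n)⁻¹ * g x ^ 2) ^ (p - 1) * (((2 : ℝ) ^ n)⁻¹ * g x) ^ (2 - p) =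
      ((2 : ℝ) ^ n)⁻¹ * g x ^ p := fun x => by
    rw [Real.mul_rpow hc (sq_nonneg _), Real.mul_rpow hc (hg x), mul_mul_mul_comm,
      ← Real.rpow_add hc', show p - 1 + (2 - p) = 1 by ring, Real.rpow_one, ← Real.rpow_two,
      ← Real.rpow_mul (hg x)]
    congr 1
    rcases (hg x).eq_or_lt with h | h
    · rw [← h, Real.zero_rpow (by positivity), Real.zero_rpow hb.ne', mul_zero,
        Real.zero_rpow (by positivity)]
    · rw [← Real.rpow_add h]
      congr 1
      ring
  simp only [e1, e2, e3, one_div, inv_inv, ← Finset.mul_sum] at h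
  exact h

theorem expect_sq_le_expect_sq (g : Hypercube n → ℝ) : (expect g) ^ 2 ≤ expect fun x => g x ^ 2 := by
  have h := Finset.sum_mul_sq_le_sq_mul_sq Finset.univ (fun _ : Hypercube n => (1 : ℝ)) g
  simp only [one_mul, one_pow, Finset.sum_const, Finset.card_univ, Fintype.card_fun, nsmul_eq_mul,
    Fintype.card_fin, Fintype.card_units_int, mul_one, Nat.cast_pow, Nat.cast_ofNat] at h
  rw [expect_real, expect_real, mul_pow]
  calc (((2 : ℝ) ^ n)⁻¹) ^ 2 * (∑ x, g x) ^ 2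
      ≤ (((2 : ℝ) ^ n)⁻¹) ^ 2 * (2 ^ n * ∑ x, g x ^ 2) :=
        mul_le_mul_of_nonneg_left h (by positivity)
    _ = _ := by field_simp

/-- The noise operator contracts the `L_2` norm exponentially in the logarithm of the ratio of the
`L_2` norm and the `L_1` norm. -/
theorem expect_noise_sq_le_exp {ρ : ℝ} (h0 : 0 < ρ) (h1 : ρ < 1) (g : Hypercube n → ℝ)
    (hg : ∀ x, 0 ≤ g x) {a b : ℝ} (ha : 0 < a) (hb : 0 < b) (hb1 : expect g = b)
    (ha2 : expect (fun x => g x ^ 2) = a ^ 2) :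
    expect (fun x => noise ρ g x ^ 2) ≤ a ^ 2 * Real.exp (-(Real.log (a / b) * (1 - ρ))) := by
  have hp1 : 1 < 1 + ρ ^ 2 := by nlinarith
  have hp2 : 1 + ρ ^ 2 < 2 := by nlinarith
  have hp0 : 0 < 1 + ρ ^ 2 := by linarith
  have hba : b ≤ a := by
    have := expect_sq_le_expect_sq g
    rw [ha2, hb1] at this
    exact le_of_sq_le_sq this ha.le
  have hL : 0 ≤ Real.log (a / b) := Real.log_nonneg ((one_le_div hb).2 hba)
  have hH := expect_rpow_le hp1 hp2 g hg
  rw [ha2, hb1] at hH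
  calc expect (fun x => noise ρ g x ^ 2)
      ≤ (expect fun x => g x ^ (1 + ρ ^ 2)) ^ (2 / (1 + ρ ^ 2)) := expect_noise_sq_le h0 h1 g hg
    _ ≤ ((a ^ 2) ^ (1 + ρ ^ 2 - 1) * b ^ (2 - (1 + ρ ^ 2))) ^ (2 / (1 + ρ ^ 2)) :=
        Real.rpow_le_rpow (expect_nonneg fun x => Real.rpow_nonneg (hg x) _) hH (by positivity)
    _ = a ^ 2 * Real.exp (-(Real.log (a / b) * (2 * (1 - ρ ^ 2) / (1 + ρ ^ 2)))) := by
        rw [Real.log_div ha.ne' hb.ne']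
        conv_lhs => rw [← Real.exp_log ha, ← Real.exp_log hb]
        conv_rhs => rw [← Real.exp_log ha]
        rw [← Real.exp_nat_mul, ← Real.exp_mul, ← Real.exp_mul, ← Real.exp_add, ← Real.exp_mul,
          ← Real.exp_add, Real.log_exp]
        congr 1
        push_cast
        field_simp
        ring
    _ ≤ _ := by
        refine mul_le_mul_of_nonneg_left (Real.exp_le_exp.2 (neg_le_neg ?_)) (sq_nonneg a)
        refine mul_le_mul_of_nonneg_left ?_ hL
        -- What remains is `(1 - ρ) (1 + ρ ^ 2) ≤ 2 (1 - ρ) (1 + ρ)`.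
        rw [le_div_iff₀ hp0]
        nlinarith [mul_pos h0 (sub_pos.2 h1), mul_pos (sub_pos.2 h1) h0]

/-! ### Type 2 for biased signs and the derivative of the noise operator -/

/-- Jensen's inequality for the square of a norm under a probability weight. -/
theorem norm_sum_smul_sq_le {ι : Type*} (s : Finset ι) (w : ι → ℝ) (v : ι → E)
    (hw : ∀ i ∈ s, 0 ≤ w i) (hs : ∑ i ∈ s, w i = 1) :
    ‖∑ i ∈ s, w i • v i‖ ^ 2 ≤ ∑ i ∈ s, w i * ‖v i‖ ^ 2 := by
  have h1 : ‖∑ i ∈ s, w i • v i‖ ≤ ∑ i ∈ s, w i * ‖v i‖ :=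
    norm_sum_le_of_le _ fun i hi => by rw [norm_smul, Real.norm_of_nonneg (hw i hi)]
  calc ‖∑ i ∈ s, w i • v i‖ ^ 2 ≤ (∑ i ∈ s, w i * ‖v i‖) ^ 2 :=
        pow_le_pow_left₀ (norm_nonneg _) h1 2
    _ ≤ _ := by
        simpa using (convexOn_pow (𝕜 := ℝ) 2).map_sum_le hw hs fun i _ => norm_nonneg (v i)

/-- Exchanging the coordinates of two points at the places where `e` is not `1`. -/
def swapAt (e : Hypercube n) : Equiv.Perm (Hypercube n × Hypercube n) :=
  Function.Involutive.toPerm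
    (fun q => (fun i => if e i = 1 then q.1 i else q.2 i, fun i => if e i = 1 then q.2 i else q.1 i))
    fun q => by
      refine Prod.ext (funext fun i => ?_) (funext fun i => ?_) <;>
        by_cases h : e i = 1 <;> simp [h]

theorem swapAt_fst (e : Hypercube n) (q : Hypercube n × Hypercube n) (i : Fin n) :
    (swapAt e q).1 i = if e i = 1 then q.1 i else q.2 i := rfl

theorem swapAt_snd (e : Hypercube n) (q : Hypercube n × Hypercube n) (i : Fin n) :
    (swapAt e q).2 i = if e i = 1 then q.2 i else q.1 i := rfl

theorem bias_mul_bias_swapAt (ρ : ℝ) (e : Hypercube n) (q : Hypercube n × Hypercube n) :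
    bias ρ (swapAt e q).1 * bias ρ (swapAt e q).2 = bias ρ q.1 * bias ρ q.2 := by
  simp only [bias, ← Finset.prod_mul_distrib]
  refine Finset.prod_congr rfl fun i _ => ?_
  by_cases h : e i = 1
  · simp [swapAt_fst, swapAt_snd, h]
  · simp [swapAt_fst, swapAt_snd, h, mul_comm]

/-- Together with `bias_mul_bias_swapAt`, this makes the differences of two independent copies
symmetric coordinate by coordinate, so that arbitrary signs may be inserted. -/
theorem coord_sub_coord_swapAt (e : Hypercube n) (q : Hypercube n × Hypercube n) (i : Fin n) :
    ((((swapAt e q).1 i : ℤˣ) : ℤ) : ℝ) - (((swapAt e q).2 i : ℤˣ) : ℤ) =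
      ((e i : ℤ) : ℝ) * ((((q.1 i : ℤˣ) : ℤ) : ℝ) - ((q.2 i : ℤˣ) : ℤ)) := by
  rcases Int.units_eq_one_or (e i) with h | h
  · simp [swapAt_fst, swapAt_snd, h]
  · simp [swapAt_fst, swapAt_snd, h]

theorem expect_norm_sum_sq_le {T : ℝ} (hT : HasRademacherTypeWith E 2 T) (v : Fin n → E) :
    expect (fun e : Hypercube n => ‖∑ i, ((e i : ℤ) : ℝ) • v i‖ ^ 2) ≤ T ^ 2 * ∑ i, ‖v i‖ ^ 2 := by
  simpa only [Real.rpow_two] using hT n v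

/-- Type `2` for centred biased signs, by symmetrization. -/
theorem sum_bias_mul_norm_sq_le {T : ℝ} (hT : HasRademacherTypeWith E 2 T) {ρ : ℝ} (h0 : 0 ≤ ρ)
    (h1 : ρ ≤ 1) (v : Fin n → E) :
    ∑ z, bias ρ z * ‖∑ i, ((((z i : ℤˣ) : ℤ) : ℝ) - ρ) • v i‖ ^ 2 ≤
      2 * T ^ 2 * (1 - ρ ^ 2) * ∑ i, ‖v i‖ ^ 2 := by
  set c : Hypercube n → Fin n → ℝ := fun z i => (((z i : ℤˣ) : ℤ) : ℝ) with hc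
  set D : Hypercube n × Hypercube n → Fin n → ℝ := fun q i => c q.1 i - c q.2 i with hD
  set W : Hypercube n × Hypercube n → ℝ := fun q => bias ρ q.1 * bias ρ q.2 with hW
  have hW0 : ∀ q, 0 ≤ W q := fun q => mul_nonneg (bias_nonneg h0 h1 _) (bias_nonneg h0 h1 _)
  have jensen : ∑ z, bias ρ z * ‖∑ i, (c z i - ρ) • v i‖ ^ 2 ≤
      ∑ q, W q * ‖∑ i, D q i • v i‖ ^ 2 := by
    rw [Fintype.sum_prod_type]
    refine Finset.sum_le_sum fun z _ => ?_
    simp only [hW, mul_assoc, ← Finset.mul_sum]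
    refine mul_le_mul_of_nonneg_left ?_ (bias_nonneg h0 h1 z)
    -- The mean `ρ` is replaced by the average over an independent copy `z'`.
    have hz : ∑ i, (c z i - ρ) • v i = ∑ z', bias ρ z' • ∑ i, D (z, z') i • v i := by
      simp only [Finset.smul_sum, smul_smul, hD]
      rw [Finset.sum_comm]
      refine Finset.sum_congr rfl fun i _ => ?_
      rw [← Finset.sum_smul]
      simp only [mul_sub, Finset.sum_sub_distrib, ← Finset.sum_mul, sum_bias, hc,
        sum_bias_mul_coord, one_mul]
    rw [hz]
    exact norm_sum_smul_sq_le _ _ _ (fun z' _ => bias_nonneg h0 h1 z') (sum_bias ρ)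
  have symm : ∀ e : Hypercube n, ∑ q, W q * ‖∑ i, D q i • v i‖ ^ 2 =
      ∑ q, W q * ‖∑ i, ((e i : ℤ) : ℝ) • (D q i • v i)‖ ^ 2 := by
    intro e
    rw [← Equiv.sum_comp (swapAt e)]
    refine Finset.sum_congr rfl fun q _ => ?_
    simp only [hW, bias_mul_bias_swapAt, hD, hc, coord_sub_coord_swapAt, mul_smul]
  have moment : ∀ i, ∑ q, W q * D q i ^ 2 = 2 * (1 - ρ ^ 2) := by
    intro i
    have : ∀ q, W q * D q i ^ 2 =
        2 * (bias ρ q.1 * bias ρ q.2) - 2 * (bias ρ q.1 * c q.1 i) * (bias ρ q.2 * c q.2 i) := by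
      intro q
      have e1 := coe_unit_sq (q.1 i)
      have e2 := coe_unit_sq (q.2 i)
      simp only [hW, hD, hc]
      linear_combination bias ρ q.1 * bias ρ q.2 * (e1 + e2)
    simp only [this, Finset.sum_sub_distrib, Fintype.sum_prod_type, ← Finset.mul_sum,
      ← Finset.sum_mul, sum_bias, hc, sum_bias_mul_coord]
    ring
  calc _ ≤ ∑ q, W q * ‖∑ i, D q i • v i‖ ^ 2 := jensen
    _ = expect fun e : Hypercube n => ∑ q, W q * ‖∑ i, ((e i : ℤ) : ℝ) • (D q i • v i)‖ ^ 2 := by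
        simp only [← symm, expect_const]
    _ = ∑ q, W q * expect fun e : Hypercube n => ‖∑ i, ((e i : ℤ) : ℝ) • (D q i • v i)‖ ^ 2 := by
        rw [expect_sum]
        simp only [expect_mul_left]
    _ ≤ ∑ q, W q * (T ^ 2 * ∑ i, ‖D q i • v i‖ ^ 2) :=
        Finset.sum_le_sum fun q _ => mul_le_mul_of_nonneg_left
          (expect_norm_sum_sq_le hT _) (hW0 q)
    _ = T ^ 2 * ∑ i, (∑ q, W q * D q i ^ 2) * ‖v i‖ ^ 2 := by
        simp only [norm_smul, mul_pow, Real.norm_eq_abs, sq_abs, Finset.mul_sum, Finset.sum_mul]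
        rw [Finset.sum_comm]
        refine Finset.sum_congr rfl fun i _ => Finset.sum_congr rfl fun q _ => ?_
        ring
    _ = _ := by
        simp only [moment, ← Finset.mul_sum]
        ring

/-- The derivative of the noise operator is controlled by the partial derivatives. -/
theorem expect_norm_sum_biasDeriv_sq_le {T : ℝ} (hT : HasRademacherTypeWith E 2 T) {ρ : ℝ}
    (h0 : 0 ≤ ρ) (h1 : ρ < 1) (g : Hypercube n → E) :
    (1 - ρ ^ 2) * expect (fun x => ‖∑ z, biasDeriv ρ z • g (x * z)‖ ^ 2) ≤
      2 * T ^ 2 * ∑ i, expect fun x => ‖partialDeriv i g x‖ ^ 2 := by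
  have hρ : 0 < 1 - ρ ^ 2 := by nlinarith
  refine le_of_mul_le_mul_left ?_ hρ
  calc (1 - ρ ^ 2) * ((1 - ρ ^ 2) * expect fun x => ‖∑ z, biasDeriv ρ z • g (x * z)‖ ^ 2)
      = expect fun x => ‖∑ z, bias ρ z •
          ∑ i, ((((z i : ℤˣ) : ℤ) : ℝ) - ρ) • partialDeriv i g (x * z)‖ ^ 2 := by
        simp only [← one_sub_sq_smul_sum_biasDeriv, norm_smul, Real.norm_of_nonneg hρ.le, mul_pow,
          expect_mul_left]
        ring
    _ ≤ expect fun x => ∑ z, bias ρ z *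
          ‖∑ i, ((((z i : ℤˣ) : ℤ) : ℝ) - ρ) • partialDeriv i g (x * z)‖ ^ 2 :=
        expect_mono fun x => norm_sum_smul_sq_le _ _ _ (fun z _ => bias_nonneg h0 h1.le z)
          (sum_bias ρ)
    -- For each fixed `z` the uniform measure is invariant under `x ↦ x * z`; afterwards the vectors
    -- no longer depend on `z` and type 2 applies for each `x`.
    _ = expect fun x => ∑ z, bias ρ z *
          ‖∑ i, ((((z i : ℤˣ) : ℤ) : ℝ) - ρ) • partialDeriv i g x‖ ^ 2 := by
        rw [expect_sum, expect_sum]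
        refine Finset.sum_congr rfl fun z _ => ?_
        rw [expect_mul_left, expect_mul_left]
        congr 1
        exact expect_mul_right
          (fun x => ‖∑ i, ((((z i : ℤˣ) : ℤ) : ℝ) - ρ) • partialDeriv i g x‖ ^ 2) z
    _ ≤ expect fun x => 2 * T ^ 2 * (1 - ρ ^ 2) * ∑ i, ‖partialDeriv i g x‖ ^ 2 :=
        expect_mono fun x => sum_bias_mul_norm_sq_le hT h0 h1.le _
    _ = _ := by
        rw [expect_mul_left, expect_sum]
        ring

end Hypercube

/-! ### Integrals in the time variable -/

/-- By convexity `Γ(a + 1) ≤ max (Γ 1) (Γ 2) = 1`, hence `Γ(a) ≤ 1 / a`. -/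
theorem Real.Gamma_le_two {a : ℝ} (h0 : 1 / 2 ≤ a) (h1 : a ≤ 1) : Real.Gamma a ≤ 2 := by
  have hG := Real.convexOn_Gamma.le_max_of_mem_Icc (x := 1) (y := 2) (z := a + 1)
    (by simp) (by simp) ⟨by linarith, by linarith⟩
  rw [Real.Gamma_one, Real.Gamma_two, max_self, Real.Gamma_add_one (by linarith)] at hG
  have := Real.Gamma_pos_of_pos (show 0 < a by linarith)
  nlinarith

/-- Dropping the exponential bounds the integral by `2`; extending it to the half-line bounds `L ^
(1 - ε)` times it by `Γ(1 - ε) ≤ 2`. The two bounds are added. -/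
theorem integral_rpow_neg_mul_exp_le {ε L : ℝ} (hε : 0 < ε) (hε' : ε ≤ 1 / 2) (hL : 0 ≤ L) :
    ∫ u in (0 : ℝ)..1, u ^ (-ε) * Real.exp (-(L * u)) ≤ 4 / (1 + L ^ (1 - ε)) := by
  have hi : IntervalIntegrable (fun u : ℝ => u ^ (-ε) * Real.exp (-(L * u)))
      MeasureTheory.volume 0 1 :=
    (intervalIntegral.intervalIntegrable_rpow' (by linarith)).mul_continuousOn (by fun_prop)
  have hle2 : ∫ u in (0 : ℝ)..1, u ^ (-ε) * Real.exp (-(L * u)) ≤ 2 := by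
    calc ∫ u in (0 : ℝ)..1, u ^ (-ε) * Real.exp (-(L * u)) ≤ ∫ u in (0 : ℝ)..1, u ^ (-ε) := by
          refine intervalIntegral.integral_mono_on zero_le_one hi
            (intervalIntegral.intervalIntegrable_rpow' (by linarith)) fun u hu => ?_
          refine mul_le_of_le_one_right (Real.rpow_nonneg hu.1 _) (Real.exp_le_one_iff.2 ?_)
          exact neg_nonpos.2 (mul_nonneg hL hu.1)
      _ = 1 / (1 - ε) := by
          rw [integral_rpow (Or.inl (by linarith)), Real.one_rpow, Real.zero_rpow (by linarith)]
          ring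
      _ ≤ 2 := by rw [div_le_iff₀ (by linarith)]; linarith
  have hmul : L ^ (1 - ε) * ∫ u in (0 : ℝ)..1, u ^ (-ε) * Real.exp (-(L * u)) ≤ 2 := by
    rcases hL.eq_or_lt with rfl | hL0
    · rw [Real.zero_rpow (by linarith), zero_mul]; norm_num
    have hI : ∫ u in (0 : ℝ)..1, u ^ (-ε) * Real.exp (-(L * u)) ≤
        (1 / L) ^ (1 - ε) * Real.Gamma (1 - ε) := by
      rw [← Real.integral_rpow_mul_exp_neg_mul_Ioi (by linarith) hL0,
        intervalIntegral.integral_of_le zero_le_one, show 1 - ε - 1 = -ε by ring]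
      refine MeasureTheory.setIntegral_mono_set ?_ ?_ Set.Ioc_subset_Ioi_self.eventuallyLE
      · have := integrableOn_rpow_mul_exp_neg_mul_rpow (s := -ε) (p := 1) (b := L)
          (by linarith) zero_lt_one hL0
        simpa using this
      · filter_upwards [MeasureTheory.ae_restrict_mem measurableSet_Ioi] with u hu
        exact mul_nonneg (Real.rpow_nonneg (le_of_lt hu) _) (Real.exp_nonneg _)
    calc _ ≤ L ^ (1 - ε) * ((1 / L) ^ (1 - ε) * Real.Gamma (1 - ε)) :=
          mul_le_mul_of_nonneg_left hI (by positivity)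
      _ = Real.Gamma (1 - ε) := by
          rw [← mul_assoc, ← Real.mul_rpow hL (by positivity), mul_one_div_cancel hL0.ne',
            Real.one_rpow, one_mul]
      _ ≤ 2 := Real.Gamma_le_two (by linarith) (by linarith)
  rw [le_div_iff₀ (by positivity)]
  linarith

theorem sq_le_mul_of_forall_le {A B X : ℝ} (hA : 0 < A) (hB : 0 ≤ B) (hX : 0 ≤ X)
    (h : ∀ l : ℝ, 0 < l → X ≤ l * A / 2 + B / (2 * l)) : X ^ 2 ≤ A * B := by
  rcases hX.eq_or_lt with rfl | hX0
  · simpa using mul_nonneg hA.le hB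
  have := h (X / A) (by positivity)
  rw [show X / A * A / 2 + B / (2 * (X / A)) = X / 2 + A * B / (2 * X) by field_simp] at this
  have h2 : X / 2 ≤ A * B / (2 * X) := by linarith
  rw [le_div_iff₀ (by positivity)] at h2
  linarith

/-- A path whose squared speed is at most `K² S(1 - t) / (1 - t)` has squared displacement at most
`K² / ε` times the integral of `u ^ (-ε) S(u)`. -/
theorem norm_sub_sq_le_integral {F : Type*} [NormedAddCommGroup F] [NormedSpace ℝ F]
    [CompleteSpace F] {G G' : ℝ → F} (hG : ∀ t, HasDerivAt G (G' t) t) (hG' : Continuous G')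
    {S : ℝ → ℝ} (hS : Continuous S) (hS0 : ∀ u, 0 ≤ S u) {K ε : ℝ} (hK : 0 < K) (hε : 0 < ε)
    (hε1 : ε < 1) (hb : ∀ t ∈ Set.Ioo (0 : ℝ) 1, (1 - t) * ‖G' t‖ ^ 2 ≤ K ^ 2 * S (1 - t)) :
    ‖G 1 - G 0‖ ^ 2 ≤ K ^ 2 / ε * ∫ u in (0 : ℝ)..1, u ^ (-ε) * S u := by
  have hi1 : IntervalIntegrable (fun u : ℝ => u ^ (ε - 1)) MeasureTheory.volume 0 1 :=
    intervalIntegral.intervalIntegrable_rpow' (by linarith)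
  have hi2 : IntervalIntegrable (fun u : ℝ => u ^ (-ε) * S u) MeasureTheory.volume 0 1 :=
    (intervalIntegral.intervalIntegrable_rpow' (by linarith)).mul_continuousOn hS.continuousOn
  set Q := ∫ u in (0 : ℝ)..1, u ^ (-ε) * S u with hQ
  have hQ0 : 0 ≤ Q := intervalIntegral.integral_nonneg zero_le_one fun u hu =>
    mul_nonneg (Real.rpow_nonneg hu.1 _) (hS0 u)
  have hFTC : ∫ t in (0 : ℝ)..1, G' t = G 1 - G 0 :=
    intervalIntegral.integral_eq_sub_of_hasDerivAt (fun t _ => hG t) (hG'.intervalIntegrable 0 1)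
  have key : ∀ l : ℝ, 0 < l → ‖G 1 - G 0‖ ≤ l * (K / ε) / 2 + K * Q / (2 * l) := by
    intro l hl
    -- The product of the two summands is `K ^ 2 S(u) / (4 u)`, so AM-GM makes `H` dominate the
    -- speed; optimizing over `l` afterwards amounts to Cauchy–Schwarz.
    set H : ℝ → ℝ := fun u => K * l / 2 * u ^ (ε - 1) + K / (2 * l) * (u ^ (-ε) * S u) with hH
    have hHi : IntervalIntegrable H MeasureTheory.volume 0 1 :=
      (hi1.const_mul _).add (hi2.const_mul _)
    have hHi' : IntervalIntegrable (fun t => H (1 - t)) MeasureTheory.volume 0 1 := by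
      have := hHi.comp_sub_left 1
      rw [sub_zero, sub_self] at this
      exact this.symm
    calc ‖G 1 - G 0‖ ≤ ∫ t in (0 : ℝ)..1, ‖G' t‖ := by
          rw [← hFTC]
          exact intervalIntegral.norm_integral_le_integral_norm zero_le_one
      _ ≤ ∫ t in (0 : ℝ)..1, H (1 - t) := by
          refine intervalIntegral.integral_mono_on_of_le_Ioo zero_le_one
            (hG'.norm.intervalIntegrable 0 1) hHi' fun t ht => ?_
          have hu : 0 < 1 - t := by linarith [ht.2]
          have hb' := hb t ht
          set u := 1 - t
          have hSu := hS0 u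
          refine le_of_sq_le_sq ?_ (by simp only [hH]; positivity)
          have hprod : u ^ (ε - 1) * u ^ (-ε) = u⁻¹ := by
            rw [← Real.rpow_add hu, show ε - 1 + -ε = -1 by ring, Real.rpow_neg_one]
          calc ‖G' t‖ ^ 2 ≤ u⁻¹ * (K ^ 2 * S u) := by rwa [le_inv_mul_iff₀ hu]
            _ = 4 * (K * l / 2 * u ^ (ε - 1)) * (K / (2 * l) * (u ^ (-ε) * S u)) := by
                rw [← hprod]; field_simp; ring
            _ ≤ H u ^ 2 := four_mul_le_sq_add _ _
      _ = ∫ u in (0 : ℝ)..1, H u := by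
          rw [intervalIntegral.integral_comp_sub_left H 1, sub_self, sub_zero]
      _ = _ := by
          rw [hH, intervalIntegral.integral_add (hi1.const_mul _) (hi2.const_mul _),
            intervalIntegral.integral_const_mul, intervalIntegral.integral_const_mul, ← hQ,
            integral_rpow (Or.inl (by linarith)), sub_add_cancel, Real.one_rpow,
            Real.zero_rpow hε.ne', sub_zero]
          field_simp
  have := sq_le_mul_of_forall_le (div_pos hK hε) (mul_nonneg hK.le hQ0) (norm_nonneg _) key
  calc _ ≤ _ := this
    _ = _ := by ring

/-! ### The noise path and the first inequality -/

namespace Hypercube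

variable {n : ℕ} {E : Type*} [NormedAddCommGroup E] [NormedSpace ℝ E]

theorem lpNorm_one (F : Hypercube n → E) : lpNorm 1 F = expect fun x => ‖F x‖ := by
  simp [lpNorm]

theorem lpNorm_two_sq (F : Hypercube n → E) : lpNorm 2 F ^ 2 = expect fun x => ‖F x‖ ^ 2 := by
  have h : 0 ≤ expect fun x => ‖F x‖ ^ 2 := expect_nonneg fun x => sq_nonneg _
  simp only [lpNorm, Real.rpow_two, ← Real.sqrt_eq_rpow, Real.sq_sqrt h]

theorem lpNorm_nonneg (p : ℝ) (F : Hypercube n → E) : 0 ≤ lpNorm p F :=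
  Real.rpow_nonneg (expect_nonneg fun _ => Real.rpow_nonneg (norm_nonneg _) _) _

theorem eq_zero_of_expect_eq_zero {F : Hypercube n → ℝ} (hF : ∀ x, 0 ≤ F x) (h : expect F = 0)
    (x : Hypercube n) : F x = 0 := by
  rw [expect_real, mul_eq_zero, or_iff_right (by positivity),
    Finset.sum_eq_zero_iff_of_nonneg fun x _ => hF x] at h
  exact h x (Finset.mem_univ x)

theorem eq_zero_of_lpNorm_two_eq_zero {F : Hypercube n → E} (h : lpNorm 2 F = 0)
    (x : Hypercube n) : F x = 0 := by
  have h2 := lpNorm_two_sq F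
  rw [h, zero_pow two_ne_zero] at h2
  simpa using eq_zero_of_expect_eq_zero (fun x => sq_nonneg ‖F x‖) h2.symm x

theorem lpNorm_one_pos {F : Hypercube n → E} (h : lpNorm 2 F ≠ 0) : 0 < lpNorm 1 F := by
  refine (lpNorm_nonneg 1 F).lt_of_ne' fun h1 => h ?_
  rw [lpNorm_one] at h1
  have h0 : ∀ x, ‖F x‖ = 0 := eq_zero_of_expect_eq_zero (fun x => norm_nonneg _) h1
  have h2 := lpNorm_two_sq F
  simp only [h0, zero_pow two_ne_zero, expect_const] at h2
  exact pow_eq_zero_iff two_ne_zero |>.1 h2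

theorem lpNorm_one_le_lpNorm_two (F : Hypercube n → E) : lpNorm 1 F ≤ lpNorm 2 F := by
  refine le_of_sq_le_sq ?_ (lpNorm_nonneg 2 F)
  rw [lpNorm_one, lpNorm_two_sq]
  exact expect_sq_le_expect_sq _

theorem one_le_normRatio {i : Fin n} {f : Hypercube n → E} (h : lpNorm 2 (partialDeriv i f) ≠ 0) :
    1 ≤ normRatio i f :=
  (one_le_div (lpNorm_one_pos h)).2 (lpNorm_one_le_lpNorm_two _)

theorem log_normRatio_nonneg (i : Fin n) (f : Hypercube n → E) : 0 ≤ Real.log (normRatio i f) := by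
  by_cases h : lpNorm 2 (partialDeriv i f) = 0
  · simp [normRatio, h]
  · exact Real.log_nonneg (one_le_normRatio h)

theorem expect_norm_noise_partialDeriv_sq_le {ρ : ℝ} (h0 : 0 < ρ) (h1 : ρ < 1) (i : Fin n)
    (f : Hypercube n → E) : expect (fun x => ‖noise ρ (partialDeriv i f) x‖ ^ 2) ≤
      lpNorm 2 (partialDeriv i f) ^ 2 * Real.exp (-(Real.log (normRatio i f) * (1 - ρ))) := by
  by_cases h : lpNorm 2 (partialDeriv i f) = 0
  · have hz : ∀ x, noise ρ (partialDeriv i f) x = 0 := fun x =>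
      Finset.sum_eq_zero fun z _ => by rw [eq_zero_of_lpNorm_two_eq_zero h, smul_zero]
    simp only [hz, h, norm_zero, zero_pow two_ne_zero, expect_const, zero_mul, le_refl]
  · calc expect (fun x => ‖noise ρ (partialDeriv i f) x‖ ^ 2)
        ≤ expect fun x => noise ρ (fun y => ‖partialDeriv i f y‖) x ^ 2 :=
          expect_mono fun x => pow_le_pow_left₀ (norm_nonneg _) (norm_noise_le h0.le h1.le _ x) 2
      _ ≤ _ := expect_noise_sq_le_exp h0 h1 _ (fun _ => norm_nonneg _)
          ((lpNorm_nonneg 2 _).lt_of_ne' h) (lpNorm_one_pos h) (lpNorm_one _).symm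
          (lpNorm_two_sq _).symm

/-- The path `N_t N_t f` from `expect f` to `f` in `L_2`. -/
noncomputable def noisePath (f : Hypercube n → E) (t : ℝ) : PiLp 2 fun _ : Hypercube n => E :=
  ∑ z, ∑ w, (bias t z * bias t w) • WithLp.toLp 2 fun x => f (x * z * w)

/-- The velocity of `noisePath`. -/
noncomputable def noisePathDeriv (f : Hypercube n → E) (t : ℝ) :
    PiLp 2 fun _ : Hypercube n => E :=
  ∑ z, ∑ w, (2 * (biasDeriv t z * bias t w)) • WithLp.toLp 2 fun x => f (x * z * w)

theorem hasDerivAt_noisePath (f : Hypercube n → E) (t : ℝ) :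
    HasDerivAt (noisePath f) (noisePathDeriv f t) t := by
  have h : HasDerivAt (noisePath f) (∑ z, ∑ w, (biasDeriv t z * bias t w + bias t z * biasDeriv t w)
      • WithLp.toLp 2 fun x => f (x * z * w)) t := by
    unfold noisePath
    refine HasDerivAt.fun_sum fun z _ => HasDerivAt.fun_sum fun w _ => ?_
    exact ((hasDerivAt_bias t z).mul (hasDerivAt_bias t w)).smul_const _
  refine h.congr_deriv ?_
  -- The sum is symmetric in `z` and `w` because the cube is commutative, so both terms of the
  -- product rule coincide.
  have hswap : ∑ z, ∑ w, (bias t z * biasDeriv t w) • WithLp.toLp 2 (fun x => f (x * z * w)) =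
      ∑ z, ∑ w, (biasDeriv t z * bias t w) • WithLp.toLp 2 (fun x => f (x * z * w)) := by
    rw [Finset.sum_comm]
    refine Finset.sum_congr rfl fun z _ => Finset.sum_congr rfl fun w _ => ?_
    simp only [mul_comm (bias t w), mul_right_comm]
  simp only [noisePathDeriv, add_smul, Finset.sum_add_distrib, hswap, two_mul]

theorem continuous_noisePathDeriv (f : Hypercube n → E) : Continuous (noisePathDeriv f) := by
  unfold noisePathDeriv
  refine continuous_finsetSum _ fun z _ => continuous_finsetSum _ fun w _ => ?_
  exact (continuous_const.mul ((continuous_biasDeriv z).mul (continuous_bias w))).smul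
    continuous_const

theorem noisePath_one (f : Hypercube n → E) : noisePath f 1 = WithLp.toLp 2 f := by
  simp [noisePath, bias_one]

theorem noisePath_zero (f : Hypercube n → E) :
    noisePath f 0 = WithLp.toLp 2 fun _ => expect f := by
  ext x
  simp only [noisePath, bias_zero, WithLp.ofLp_sum, Finset.sum_apply, PiLp.smul_apply]
  have hw : ∀ z, ∑ w, (((2 : ℝ) ^ n)⁻¹ * ((2 : ℝ) ^ n)⁻¹) • f (x * z * w) =
      ((2 : ℝ) ^ n)⁻¹ • expect f := fun z => by
    rw [← Finset.smul_sum, mul_smul, expect]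
    congr 2
    exact Equiv.sum_comp (Equiv.mulLeft (x * z)) f
  simp [hw, Fintype.card_units_int, ← Nat.cast_smul_eq_nsmul ℝ, smul_smul]

theorem norm_piLp_sq {V : Type*} [NormedAddCommGroup V] (F : PiLp 2 fun _ : Hypercube n => V) :
    ‖F‖ ^ 2 = 2 ^ n * expect fun x => ‖F x‖ ^ 2 := by
  rw [PiLp.norm_sq_eq_of_L2, expect_real, mul_inv_cancel_left₀ (by positivity)]

theorem noisePathDeriv_apply (f : Hypercube n → E) (t : ℝ) (x : Hypercube n) :
    noisePathDeriv f t x = (2 : ℝ) • ∑ z, biasDeriv t z • noise t f (x * z) := by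
  simp only [noisePathDeriv, WithLp.ofLp_sum, Finset.sum_apply, PiLp.smul_apply, noise,
    Finset.smul_sum, smul_smul]

theorem norm_noisePathDeriv_sq_le {T : ℝ} (hT : HasRademacherTypeWith E 2 T) (f : Hypercube n → E)
    {t : ℝ} (ht : t ∈ Set.Ioo (0 : ℝ) 1) :
    (1 - t) * ‖noisePathDeriv f t‖ ^ 2 ≤ 8 * T ^ 2 * 2 ^ n * ∑ i, lpNorm 2 (partialDeriv i f) ^ 2 *
      Real.exp (-(Real.log (normRatio i f) * (1 - t))) := by
  obtain ⟨h0, h1⟩ := ht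
  set M := expect fun x => ‖∑ z, biasDeriv t z • noise t f (x * z)‖ ^ 2 with hM
  have hM0 : 0 ≤ M := expect_nonneg fun x => sq_nonneg _
  have hn : ‖noisePathDeriv f t‖ ^ 2 = 2 ^ n * (4 * M) := by
    rw [norm_piLp_sq]
    simp only [noisePathDeriv_apply, norm_smul, mul_pow, expect_mul_left, ← hM]
    norm_num
  have hS : (1 - t ^ 2) * M ≤ 2 * T ^ 2 * ∑ i, lpNorm 2 (partialDeriv i f) ^ 2 *
      Real.exp (-(Real.log (normRatio i f) * (1 - t))) := by
    refine (expect_norm_sum_biasDeriv_sq_le hT h0.le h1 (noise t f)).trans ?_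
    refine mul_le_mul_of_nonneg_left (Finset.sum_le_sum fun i _ => ?_) (by positivity)
    rw [← noise_partialDeriv]
    exact expect_norm_noise_partialDeriv_sq_le h0 h1 i f
  have hle : (1 - t) * M ≤ (1 - t ^ 2) * M := mul_le_mul_of_nonneg_right (by nlinarith) hM0
  have h2n : (0 : ℝ) < 2 ^ n := by positivity
  calc (1 - t) * ‖noisePathDeriv f t‖ ^ 2 = 4 * 2 ^ n * ((1 - t) * M) := by rw [hn]; ring
    _ ≤ 4 * 2 ^ n * (2 * T ^ 2 * ∑ i, lpNorm 2 (partialDeriv i f) ^ 2 *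
      Real.exp (-(Real.log (normRatio i f) * (1 - t)))) :=
        mul_le_mul_of_nonneg_left (hle.trans hS) (by positivity)
    _ = _ := by ring

/-- The constant `32` is `8` from the speed bound times `4` from the time integral; the factor `2 ^
n` comes from the unnormalized `PiLp` norm and cancels. -/
theorem lpNorm_sub_expect_sq_le_of_le_half [CompleteSpace E] {T : ℝ} (hT0 : 0 < T)
    (hT : HasRademacherTypeWith E 2 T) {ε : ℝ} (hε : 0 < ε) (hε' : ε ≤ 1 / 2)
    (f : Hypercube n → E) :
    lpNorm 2 (fun x => f x - expect f) ^ 2 ≤ 32 * T ^ 2 / ε *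
      ∑ i, lpNorm 2 (partialDeriv i f) ^ 2 / (1 + Real.log (normRatio i f) ^ (1 - ε)) := by
  have hK : (0 : ℝ) < 8 * T ^ 2 * 2 ^ n := by positivity
  have hmain := norm_sub_sq_le_integral (hasDerivAt_noisePath f) (continuous_noisePathDeriv f)
    (S := fun u => ∑ i, lpNorm 2 (partialDeriv i f) ^ 2 *
      Real.exp (-(Real.log (normRatio i f) * u)))
    (by fun_prop)
    (fun u => Finset.sum_nonneg fun i _ => by positivity) (Real.sqrt_pos.2 hK) hε
    (by linarith) fun t ht => by
      rw [Real.sq_sqrt hK.le]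
      exact norm_noisePathDeriv_sq_le hT f ht
  rw [Real.sq_sqrt hK.le, noisePath_one, noisePath_zero, norm_piLp_sq] at hmain
  have hint : ∫ u in (0 : ℝ)..1, u ^ (-ε) * ∑ i, lpNorm 2 (partialDeriv i f) ^ 2 *
      Real.exp (-(Real.log (normRatio i f) * u)) ≤
      ∑ i, lpNorm 2 (partialDeriv i f) ^ 2 * (4 / (1 + Real.log (normRatio i f) ^ (1 - ε))) := by
    simp only [Finset.mul_sum, mul_left_comm _ (lpNorm 2 _ ^ 2)]
    rw [intervalIntegral.integral_finsetSum]
    · refine Finset.sum_le_sum fun i _ => ?_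
      rw [intervalIntegral.integral_const_mul]
      exact mul_le_mul_of_nonneg_left
        (integral_rpow_neg_mul_exp_le hε hε' (log_normRatio_nonneg i f)) (sq_nonneg _)
    · intro i _
      exact ((intervalIntegral.intervalIntegrable_rpow' (by linarith)).mul_continuousOn
        (by fun_prop)).const_mul _
  have h2n : (0 : ℝ) < 2 ^ n := by positivity
  refine le_of_mul_le_mul_left ?_ h2n
  rw [lpNorm_two_sq]
  refine hmain.trans ((mul_le_mul_of_nonneg_left hint (by positivity)).trans_eq ?_)
  simp only [Finset.mul_sum]
  refine Finset.sum_congr rfl fun i _ => ?_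
  field_simp
  ring

theorem lpNorm_sub_expect_sq_le [CompleteSpace E] {T : ℝ} (hT0 : 0 < T)
    (hT : HasRademacherTypeWith E 2 T) {ε : ℝ} (hε : 0 < ε) (hε1 : ε < 1)
    (f : Hypercube n → E) :
    lpNorm 2 (fun x => f x - expect f) ^ 2 ≤ 128 * T ^ 2 / ε *
      ∑ i, lpNorm 2 (partialDeriv i f) ^ 2 / (1 + Real.log (normRatio i f) ^ (1 - ε)) := by
  have hs : 0 ≤ ∑ i, lpNorm 2 (partialDeriv i f) ^ 2 /
      (1 + Real.log (normRatio i f) ^ (1 - ε)) := Finset.sum_nonneg fun i _ => by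
    have := log_normRatio_nonneg i f
    positivity
  rcases le_or_gt ε (1 / 2) with h | h
  · refine (lpNorm_sub_expect_sq_le_of_le_half hT0 hT hε h f).trans
      (mul_le_mul_of_nonneg_right ?_ hs)
    gcongr
    norm_num
  -- For `ε > 1 / 2` the case `1 / 2` suffices: `L ^ (1 - ε) ≤ 1 + L ^ (1 / 2)` costs a factor `2`,
  -- and `1 ≤ 1 / ε`.
  · have h1 := lpNorm_sub_expect_sq_le_of_le_half hT0 hT one_half_pos le_rfl f
    have h2 : ∑ i, lpNorm 2 (partialDeriv i f) ^ 2 /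
          (1 + Real.log (normRatio i f) ^ (1 - 1 / 2 : ℝ)) ≤
        2 * ∑ i, lpNorm 2 (partialDeriv i f) ^ 2 / (1 + Real.log (normRatio i f) ^ (1 - ε)) := by
      rw [Finset.mul_sum]
      refine Finset.sum_le_sum fun i _ => ?_
      have hL := log_normRatio_nonneg i f
      set L := Real.log (normRatio i f)
      have hLe : L ^ (1 - ε) ≤ 1 + L ^ (1 - 1 / 2 : ℝ) := by
        rcases le_total L 1 with h' | h'
        · linarith [Real.rpow_le_one hL h' (by linarith : 0 ≤ 1 - ε),
            Real.rpow_nonneg hL (1 - 1 / 2)]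
        · linarith [Real.rpow_le_rpow_of_exponent_le h' (by linarith : 1 - ε ≤ 1 - 1 / 2)]
      have hp := Real.rpow_nonneg hL (1 - 1 / 2)
      rw [mul_div_assoc', div_le_div_iff₀ (by positivity) (by positivity)]
      nlinarith [mul_nonneg (sq_nonneg (lpNorm 2 (partialDeriv i f)))
        (show 0 ≤ 2 * (1 + L ^ (1 - 1 / 2 : ℝ)) - (1 + L ^ (1 - ε)) by linarith)]
    calc _ ≤ _ := h1
      _ ≤ 32 * T ^ 2 / (1 / 2) * (2 * ∑ i, lpNorm 2 (partialDeriv i f) ^ 2 /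
            (1 + Real.log (normRatio i f) ^ (1 - ε))) :=
          mul_le_mul_of_nonneg_left h2 (by positivity)
      _ = 128 * T ^ 2 / 1 * ∑ i, lpNorm 2 (partialDeriv i f) ^ 2 /
            (1 + Real.log (normRatio i f) ^ (1 - ε)) := by ring
      _ ≤ _ := by gcongr

/-! ### The log-log factor and the second inequality -/

theorem log_log_le_logLogFactor (i : Fin n) (f : Hypercube n → E) :
    Real.log (Real.log (Real.exp 1 + normRatio i f)) ≤ logLogFactor f :=
  le_ciSup (f := fun i : Fin n => Real.log (Real.log (Real.exp 1 + normRatio i f)))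
    (Set.finite_range _).bddAbove i

theorem log_normRatio_le_exp_logLogFactor (i : Fin n) (f : Hypercube n → E) :
    Real.log (normRatio i f) ≤ Real.exp (logLogFactor f) := by
  have hr : 0 ≤ normRatio i f := div_nonneg (lpNorm_nonneg _ _) (lpNorm_nonneg _ _)
  have he : 1 ≤ Real.log (Real.exp 1 + normRatio i f) := by
    rw [Real.le_log_iff_exp_le (by positivity)]
    linarith
  rcases hr.eq_or_lt with h | h
  · rw [← h, Real.log_zero]
    exact (Real.exp_pos _).le
  calc Real.log (normRatio i f) ≤ Real.log (Real.exp 1 + normRatio i f) :=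
        Real.log_le_log h (by linarith [Real.exp_pos 1])
    _ = Real.exp (Real.log (Real.log (Real.exp 1 + normRatio i f))) :=
        (Real.exp_log (by linarith)).symm
    _ ≤ _ := Real.exp_le_exp.2 (log_log_le_logLogFactor i f)

theorem log_log_exp_one_add_one_pos : 0 < Real.log (Real.log (Real.exp 1 + 1)) := by
  refine Real.log_pos ?_
  rw [Real.lt_log_iff_exp_lt (by positivity)]
  linarith

/-- A positive lower bound independent of `f`, which lets additive constants be absorbed into
multiples of `logLogFactor f`. -/
theorem log_log_le_logLogFactor_of_ne {i : Fin n} {f : Hypercube n → E}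
    (h : lpNorm 2 (partialDeriv i f) ≠ 0) :
    Real.log (Real.log (Real.exp 1 + 1)) ≤ logLogFactor f := by
  refine le_trans ?_ (log_log_le_logLogFactor i f)
  have h1 : 0 < Real.log (Real.exp 1 + 1) := Real.log_pos (by linarith [Real.exp_pos 1])
  exact Real.log_le_log h1 (Real.log_le_log (by positivity) (by linarith [one_le_normRatio h]))

theorem lpNorm_sub_expect_sq_le_logLogFactor [CompleteSpace E] {T : ℝ} (hT0 : 0 < T)
    (hT : HasRademacherTypeWith E 2 T) (f : Hypercube n → E) :
    lpNorm 2 (fun x => f x - expect f) ^ 2 ≤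
      96 * T ^ 2 * (2 / Real.log (Real.log (Real.exp 1 + 1)) + 1) * logLogFactor f *
        ∑ i, lpNorm 2 (partialDeriv i f) ^ 2 / (1 + Real.log (normRatio i f)) := by
  by_cases hz : ∀ i, lpNorm 2 (partialDeriv i f) = 0
  · have := lpNorm_sub_expect_sq_le_of_le_half hT0 hT one_half_pos le_rfl f
    simp only [hz, zero_pow two_ne_zero, zero_div, Finset.sum_const_zero, mul_zero] at this ⊢
    exact this
  push Not at hz
  obtain ⟨j, hj⟩ := hz
  have hs0 := log_log_exp_one_add_one_pos
  have hs := log_log_le_logLogFactor_of_ne hj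
  set s₀ := Real.log (Real.log (Real.exp 1 + 1))
  set s := logLogFactor f with hsdef
  have hspos : 0 < s := hs0.trans_le hs
  -- The `2` keeps this exponent at most `1 / 2`; since `s ε ≤ 1` and `L ≤ exp s`, it gives `L ^ ε ≤
  -- e ≤ 3`.
  have hε : 0 < 1 / (2 + s) := by positivity
  have hε' : 1 / (2 + s) ≤ 1 / 2 := one_div_le_one_div_of_le two_pos (by linarith)
  have hε1 : 0 < 1 - 1 / (2 + s) := by linarith
  have hmain := lpNorm_sub_expect_sq_le_of_le_half hT0 hT hε hε' f
  set ε := 1 / (2 + s) with hεdef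
  have hcmp : ∑ i, lpNorm 2 (partialDeriv i f) ^ 2 / (1 + Real.log (normRatio i f) ^ (1 - ε)) ≤
      3 * ∑ i, lpNorm 2 (partialDeriv i f) ^ 2 / (1 + Real.log (normRatio i f)) := by
    rw [Finset.mul_sum]
    refine Finset.sum_le_sum fun i _ => ?_
    have hL := log_normRatio_nonneg i f
    have hLs : Real.log (normRatio i f) ≤ Real.exp s := log_normRatio_le_exp_logLogFactor i f
    set L := Real.log (normRatio i f)
    have hp := Real.rpow_nonneg hL (1 - ε)
    have hLe : L ≤ 3 * L ^ (1 - ε) := by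
      rcases hL.eq_or_lt with h | h
      · rw [← h, Real.zero_rpow hε1.ne', mul_zero]
      calc L = L ^ ε * L ^ (1 - ε) := by rw [← Real.rpow_add h, add_sub_cancel, Real.rpow_one]
        _ ≤ 3 * L ^ (1 - ε) := by
            refine mul_le_mul_of_nonneg_right ?_ hp
            calc L ^ ε ≤ (Real.exp s) ^ ε := Real.rpow_le_rpow hL hLs hε.le
              _ = Real.exp (s * ε) := (Real.exp_mul _ _).symm
              _ ≤ Real.exp 1 := by
                  refine Real.exp_le_exp.2 ?_
                  rw [hεdef, mul_one_div, div_le_one (by positivity)]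
                  linarith
              _ ≤ 3 := Real.exp_one_lt_three.le
    rw [mul_div_assoc', div_le_div_iff₀ (by positivity) (by positivity)]
    nlinarith [mul_nonneg (sq_nonneg (lpNorm 2 (partialDeriv i f)))
      (show 0 ≤ 3 * (1 + L ^ (1 - ε)) - (1 + L) by linarith)]
  have hnn : 0 ≤ ∑ i, lpNorm 2 (partialDeriv i f) ^ 2 / (1 + Real.log (normRatio i f)) :=
    Finset.sum_nonneg fun i _ => by
      have := log_normRatio_nonneg i f
      positivity
  have h2s : 2 + s ≤ (2 / s₀ + 1) * s := by
    have : 2 ≤ 2 / s₀ * s := by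
      rw [div_mul_eq_mul_div, le_div_iff₀ hs0]
      linarith
    linarith
  calc _ ≤ _ := hmain
    _ ≤ 32 * T ^ 2 / ε * (3 * ∑ i, lpNorm 2 (partialDeriv i f) ^ 2 /
          (1 + Real.log (normRatio i f))) := mul_le_mul_of_nonneg_left hcmp (by positivity)
    _ = 96 * T ^ 2 * (2 + s) * ∑ i, lpNorm 2 (partialDeriv i f) ^ 2 /
          (1 + Real.log (normRatio i f)) := by
        rw [hεdef, div_div_eq_mul_div]
        ring
    _ ≤ 96 * T ^ 2 * ((2 / s₀ + 1) * s) * ∑ i, lpNorm 2 (partialDeriv i f) ^ 2 /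
          (1 + Real.log (normRatio i f)) :=
        mul_le_mul_of_nonneg_right (mul_le_mul_of_nonneg_left h2s (by positivity)) hnn
    _ = _ := by rw [← mul_assoc (96 * T ^ 2) (2 / s₀ + 1) s]

end Hypercube

theorem theorem1p1 {E : Type*} [NormedAddCommGroup E] [NormedSpace ℝ E] [CompleteSpace E]
    (hE : HasRademacherType E 2) :
    ∃ C : ℝ, 0 < C ∧
      (∀ ε : ℝ, 0 < ε → ε < 1 → ∀ (n : ℕ) (f : Hypercube n → E),
        Hypercube.lpNorm 2 (fun x => f x - Hypercube.expect f) ^ 2 ≤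
          C / ε * ∑ i : Fin n, Hypercube.lpNorm 2 (Hypercube.partialDeriv i f) ^ 2 /
            (1 + Real.log (Hypercube.normRatio i f) ^ (1 - ε))) ∧
      (∀ (n : ℕ) (f : Hypercube n → E),
        Hypercube.lpNorm 2 (fun x => f x - Hypercube.expect f) ^ 2 ≤
          C * Hypercube.logLogFactor f *
            ∑ i : Fin n, Hypercube.lpNorm 2 (Hypercube.partialDeriv i f) ^ 2 /
              (1 + Real.log (Hypercube.normRatio i f))) := by
  obtain ⟨T, hT0, hT⟩ := hE
  have hs0 := Hypercube.log_log_exp_one_add_one_pos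
  set s₀ := Real.log (Real.log (Real.exp 1 + 1)) with hs₀
  refine ⟨128 * T ^ 2 * (2 / s₀ + 1), by positivity, fun ε hε hε1 n f => ?_, fun n f => ?_⟩
  · refine (Hypercube.lpNorm_sub_expect_sq_le hT0 hT hε hε1 f).trans
      (mul_le_mul_of_nonneg_right ?_ (Finset.sum_nonneg fun i _ => ?_))
    · refine div_le_div_of_nonneg_right (le_mul_of_one_le_right (by positivity) ?_) hε.le
      linarith [div_pos two_pos hs0]
    · have := Hypercube.log_normRatio_nonneg i f
      positivity
  · refine (Hypercube.lpNorm_sub_expect_sq_le_logLogFactor hT0 hT f).trans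
      (mul_le_mul_of_nonneg_right ?_ (Finset.sum_nonneg fun i _ => ?_))
    · rw [← hs₀]
      -- Enlarging `96` to `128` needs `logLogFactor f ≥ 0`; for vanishing derivatives the ratio `0
      -- / 0 = 0` gives `log (log e) = 0`.
      by_cases hz : ∀ i, Hypercube.lpNorm 2 (Hypercube.partialDeriv i f) = 0
      · have hσ : 0 ≤ Hypercube.logLogFactor f := by
          refine Real.iSup_nonneg fun i => ?_
          simp [Hypercube.normRatio, hz i]
        gcongr
        norm_num
      · push Not at hz
        obtain ⟨j, hj⟩ := hz
        have hσ := hs0.le.trans (Hypercube.log_log_le_logLogFactor_of_ne hj)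
        gcongr
        norm_num
    · have := Hypercube.log_normRatio_nonneg i f
      positivity
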